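/- For $n\ge 0$ and a permutation $\pi=\pi_1\cdots\pi_n$ of $[n]=\{1,\dots,n\}$ let $\mathrm{exc}(\pi)=|\{i\in[n]:\pi_i>i\}|$ and $\mathrm{maj}(\pi)=\sum_{1\le i\le n-1,\ \pi_i>\pi_{i+1}} i$. Define the $(\mathrm{maj},\mathrm{exc})$-Eulerian polynomials by $$A_n(t,q)=\sum_{\pi\in\mathfrak S_n}t^{\mathrm{exc}(\pi)}q^{\mathrm{maj}(\pi)-\mathrm{exc}(\pi)}\in\mathbb Z[t,q],$$ and the $q$-binomial-Eulerian polynomials by $$\tilde A_n(t,q)=1+t\sum_{m=1}^n{n\brack m}_qA_m(t,q),\qquad {n\brack m}_q=\frac{(q;q)_n}{(q;q)_m(q;q)_{n-m}}\in\mathbb Z[q],\qquad (q;q)_n=\prod_{i=1}^n(1-q^i).$$ **Theorem.** The $q$-binomial-Eulerian polynomials satisfy $\tilde A_0(t,q)=1$ and, for every $n\ge 0$, the identity in $\mathbb Z[t,q]$ $$\tilde A_{n+1}(t,q)=(1+t)\,\tilde A_n(t,q)+t\sum_{k=1}^n{n\brack k}_q\,q^k\,A_k(t,q)\,\tilde A_{n-k}(t,q).$$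 -/

import Mathlib

/-!
Bivariate polynomials in `t` and `q` are elements of `ℤ[q][t] = Polynomial (Polynomial ℤ)`:
the outer variable is `t`, the inner one is `q`.
-/

/-- Excedances of `π ∈ S_n`. The position `i : Fin n` stands for `i + 1 ∈ [n]`; the last position
is never an excedance. -/
def excSet {n : ℕ} (π : Equiv.Perm (Fin n)) : Finset (Fin n) :=
  Finset.univ.filter fun i => i < π i

/-- Descents of `π ∈ S_n`: the positions `i ∈ [n-1]` with `π_i > π_{i+1}`. The position
`i : Fin n` stands for `i + 1 ∈ [n]`. -/
def desSet {n : ℕ} (π : Equiv.Perm (Fin n)) : Finset (Fin n) :=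
  Finset.univ.filter fun i => ∃ h : (i : ℕ) + 1 < n, π ⟨(i : ℕ) + 1, h⟩ < π i

/-- The number of excedances. -/
def exc {n : ℕ} (π : Equiv.Perm (Fin n)) : ℕ := (excSet π).card

/-- The major index: the sum of the descent positions, counted from `1`. -/
def maj {n : ℕ} (π : Equiv.Perm (Fin n)) : ℕ := ∑ i ∈ desSet π, ((i : ℕ) + 1)

/-- An upper bound for `exc`: the subtraction `maj π - exc π` below does not truncate. -/
theorem exc_le_maj {n : ℕ} (π : Equiv.Perm (Fin n)) : exc π ≤ maj π := by
  -- an excedance is weakly to the left of some descent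
  have key : ∀ i ∈ excSet π, ∃ d ∈ desSet π, i ≤ d := by
    intro i hi
    by_contra! hcon
    have hi' : (i : ℕ) < π i := by simpa [excSet] using hi
    have step : ∀ j : ℕ, ∀ h : (i : ℕ) + j < n, (i : ℕ) + j < π ⟨(i : ℕ) + j, h⟩ := by
      intro j
      induction j with
      | zero => intro h; simpa using hi'
      | succ j ih =>
        intro h
        have hj := ih (by omega)
        have hnd : (⟨(i : ℕ) + j, by omega⟩ : Fin n) ∉ desSet π := by
          intro hd
          have := hcon _ hd
          rw [Fin.lt_def] at this
          simp at this
        have hle : π ⟨(i : ℕ) + j, by omega⟩ ≤ π ⟨(i : ℕ) + (j + 1), h⟩ := by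
          by_contra! hlt
          exact hnd (by simpa [desSet] using ⟨by omega, hlt⟩)
        have hne : π ⟨(i : ℕ) + j, by omega⟩ ≠ π ⟨(i : ℕ) + (j + 1), h⟩ := by
          intro he
          have := congrArg Fin.val (π.injective he)
          simp at this
        have hlt := Fin.lt_def.1 (lt_of_le_of_ne hle hne)
        omega
    have hin := i.isLt
    have hlast := step (n - 1 - i) (by omega)
    have := (π ⟨(i : ℕ) + (n - 1 - i), by omega⟩).isLt
    omega
  rcases (desSet π).eq_empty_or_nonempty with he | hne
  · have : excSet π = ∅ := by
      refine Finset.eq_empty_of_forall_notMem fun i hi => ?_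
      obtain ⟨d, hd, _⟩ := key i hi
      simp [he] at hd
    simp [exc, this]
  · set d := (desSet π).max' hne
    have hsub : excSet π ⊆ Finset.Iic d := by
      intro i hi
      obtain ⟨e, he, hie⟩ := key i hi
      exact Finset.mem_Iic.2 (hie.trans (Finset.le_max' _ e he))
    calc exc π ≤ (Finset.Iic d).card := Finset.card_le_card hsub
      _ = (d : ℕ) + 1 := by simp
      _ ≤ maj π := Finset.single_le_sum (f := fun i : Fin n => (i : ℕ) + 1)
          (fun _ _ => Nat.zero_le _) (Finset.max'_mem _ hne)

/-- The variable `t`. -/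
noncomputable def tVar : Polynomial (Polynomial ℤ) := Polynomial.X

/-- The variable `q`. -/
noncomputable def qVar : Polynomial (Polynomial ℤ) := Polynomial.C Polynomial.X

/-- The `(maj, exc)`-Eulerian polynomial `A_n(t, q) = ∑_{π ∈ S_n} t^{exc π} q^{maj π - exc π}`. -/
noncomputable def qEulerian (n : ℕ) : Polynomial (Polynomial ℤ) :=
  ∑ π : Equiv.Perm (Fin n), tVar ^ exc π * qVar ^ (maj π - exc π)

/-- `(q; q)_n = ∏_{i=1}^n (1 - q^i)` in `ℤ[q]`. -/
noncomputable def qPoch (n : ℕ) : Polynomial ℤ :=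
  ∏ i ∈ Finset.Icc 1 n, (1 - Polynomial.X ^ i)

theorem qPoch_succ (n : ℕ) : qPoch (n + 1) = qPoch n * (1 - Polynomial.X ^ (n + 1)) := by
  unfold qPoch
  exact Finset.prod_Icc_succ_top (by omega) _

theorem qPoch_mul_dvd_add (s : ℕ) : ∀ m k : ℕ, m + k = s → qPoch m * qPoch k ∣ qPoch s := by
  induction s with
  | zero =>
    intro m k h
    obtain ⟨rfl, rfl⟩ : m = 0 ∧ k = 0 := by omega
    simp [qPoch]
  | succ s ih =>
    intro m k h
    rcases m with _ | m
    · obtain rfl : k = s + 1 := by omega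
      simp [qPoch]
    rcases k with _ | k
    · obtain rfl : m = s := by omega
      simp [qPoch]
    obtain rfl : s = m + k + 1 := by omega
    obtain ⟨a, ha⟩ := ih m (k + 1) (by omega)
    obtain ⟨b, hb⟩ := ih (m + 1) k (by omega)
    refine ⟨a + Polynomial.X ^ (m + 1) * b, ?_⟩
    have e : (1 - Polynomial.X ^ (m + k + 1 + 1) : Polynomial ℤ) =
        (1 - Polynomial.X ^ (m + 1)) +
          Polynomial.X ^ (m + 1) * (1 - Polynomial.X ^ (k + 1)) := by ring
    rw [qPoch_succ (m + k + 1), e, mul_add]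
    nth_rewrite 1 [ha]
    rw [hb, qPoch_succ m, qPoch_succ k]
    ring

theorem qPoch_mul_dvd {n m : ℕ} (h : m ≤ n) : qPoch m * qPoch (n - m) ∣ qPoch n :=
  qPoch_mul_dvd_add n m (n - m) (by omega)

theorem qPoch_ne_zero (n : ℕ) : qPoch n ≠ 0 := by
  refine Finset.prod_ne_zero_iff.2 fun i hi h => ?_
  have hi' := Finset.mem_Icc.1 hi
  have := congrArg (Polynomial.eval 0) h
  simp [show i ≠ 0 by omega] at this

open Classical in
/-- The `q`-binomial coefficient `(q; q)_n / ((q; q)_m (q; q)_{n-m})` for `m ≤ n` (and `0` for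
`m > n`), an exact quotient in `ℤ[q]`. -/
noncomputable def qBinom (n m : ℕ) : Polynomial ℤ :=
  if h : m ≤ n then (qPoch_mul_dvd h).choose else 0

theorem qBinom_spec {n m : ℕ} (h : m ≤ n) :
    qPoch n = qPoch m * qPoch (n - m) * qBinom n m := by
  unfold qBinom
  rw [dif_pos h]
  exact (qPoch_mul_dvd h).choose_spec

/-- The `q`-binomial coefficient is the only polynomial with the property in `qBinom_spec`. -/
theorem qBinom_unique {n m : ℕ} (h : m ≤ n) {p : Polynomial ℤ}
    (hp : qPoch n = qPoch m * qPoch (n - m) * p) : p = qBinom n m :=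
  mul_left_cancel₀ (mul_ne_zero (qPoch_ne_zero m) (qPoch_ne_zero (n - m)))
    (hp.symm.trans (qBinom_spec h))

/-- The `q`-binomial-Eulerian polynomial
`1 + t ∑_{m=1}^n [n, m]_q A_m(t, q)`. -/
noncomputable def qBinomialEulerian (n : ℕ) : Polynomial (Polynomial ℤ) :=
  1 + tVar * ∑ m ∈ Finset.Icc 1 n, Polynomial.C (qBinom n m) * qEulerian m

/-! Put `f(z) = ∑ A_n z^n / (q;q)_n`. Everything rests on the functional equation `f(z) (1 - (1 + t
f(qz)) z) = f(qz) (1 - t z)`. The generating function of the `q`-binomial-Eulerian polynomials is `F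
= E (1 - t + t f)` with `E(z) = ∑ z^n / (q;q)_n` and `E(qz) = (1 - z) E(z)`, so the equation becomes
`F(z) = F(qz) + z F(z) (1 + t f(qz))`, whose coefficients are the recurrence.

To make `(q;q)_n` invertible and all sums finite, `q` is taken nilpotent; the identity in `ℤ[q][t]`
follows because it holds modulo every power of `q`.

The functional equation has two sources. Combinatorially (`masterSum_eq_sum_perm`), `q^(maj - exc) /
(q;q)_n` counts sequences `s` compatible with `π`, and for fixed `s` the permutations correspond to
words with restricted letters, counted by one coefficient of a product of linear forms.
Algebraically (`mul_masterSum`), the sum of these coefficients is computed by eliminating one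
variable at a time, each elimination being a Möbius map `elimStep`. Passing from `qz` to `z` adds
exactly one elimination. -/

/-! ### Elimination of one variable. -/

open Polynomial in
/-- `∑_{g < M} y^g [X^g] (aX + b)^g P`. -/
noncomputable def diagSum {T : Type*} [CommRing T] (M : ℕ) (y a b : T) (P : T[X]) : T :=
  ∑ g ∈ Finset.range M, y ^ g * ((C a * X + C b) ^ g * P).coeff g

/-- `l ^ g` with the first factor replaced by `l - d`. -/
def firstPow {T : Type*} [CommRing T] (l d : T) : ℕ → T
  | 0 => 1
  | g + 1 => (l - d) * l ^ g

theorem map_firstPow {T T' : Type*} [CommRing T] [CommRing T'] (f : T →+* T') (l d : T) (g : ℕ) :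
    f (firstPow l d g) = firstPow (f l) (f d) g := by
  cases g <;> simp [firstPow]

section
open Polynomial
variable {T : Type*} [CommRing T] {M : ℕ} {y a b : T}

theorem sum_range_pow_succ_shift (hy : y ^ M = 0) (c : ℕ → T) :
    ∑ g ∈ Finset.range M, y ^ (g + 1) * c (g + 1) = ∑ g ∈ Finset.range M, y ^ g * c g - c 0 := by
  have h := Finset.sum_range_succ' (fun g => y ^ g * c g) M
  rw [Finset.sum_range_succ, hy] at h
  simp only [zero_mul, add_zero, pow_zero, one_mul] at h
  rw [h]; ring

/-- The factor `X` lowers the coefficient index by one and so releases one factor `aX + b`. The term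
`g = 0` vanishes, and the new top term carries `y ^ M = 0`. -/
theorem diagSum_X_mul (hy : y ^ M = 0) (P : T[X]) :
    diagSum M y a b (X * P) = y * diagSum M y a b ((C a * X + C b) * P) := by
  have h := sum_range_pow_succ_shift hy (fun g => ((C a * X + C b) ^ g * (X * P)).coeff g)
  have h0 : ((C a * X + C b) ^ 0 * (X * P)).coeff 0 = 0 := by simp
  simp only [h0, sub_zero] at h
  rw [diagSum, ← h, diagSum, Finset.mul_sum]
  refine Finset.sum_congr rfl fun g _ => ?_
  rw [show (C a * X + C b) ^ (g + 1) * (X * P)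
    = (C a * X + C b) ^ g * ((C a * X + C b) * P) * X by ring, coeff_mul_X]
  ring

theorem diagSum_add (P Q : T[X]) :
    diagSum M y a b (P + Q) = diagSum M y a b P + diagSum M y a b Q := by
  simp [diagSum, mul_add, Finset.sum_add_distrib]

theorem diagSum_C_mul (r : T) (P : T[X]) :
    diagSum M y a b (C r * P) = r * diagSum M y a b P := by
  simp only [diagSum, Finset.mul_sum]
  refine Finset.sum_congr rfl fun g _ => ?_
  rw [mul_left_comm, coeff_C_mul]
  ring

theorem diagSum_one (hy : y ^ M = 0) {u : T} (hu : u * (1 - a * y) = 1) :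
    diagSum M y a b 1 = u := by
  have hc : ∀ g : ℕ, ((C a * X + C b) ^ g * 1).coeff g = a ^ g := by
    intro g
    rw [mul_one]
    have hd : (C a * X + C b).natDegree ≤ 1 := natDegree_linear_le
    have := coeff_pow_of_natDegree_le (m := g) hd
    simpa using this
  have h1 : diagSum M y a b 1 = ∑ g ∈ Finset.range M, (a * y) ^ g := by
    refine Finset.sum_congr rfl fun g _ => ?_
    rw [hc, mul_pow, mul_comm]
  have h2 := mul_neg_geom_sum (a * y) M
  rw [← h1, mul_pow, hy, mul_zero, sub_zero] at h2
  calc diagSum M y a b 1 = u * ((1 - a * y) * diagSum M y a b 1) := by rw [← mul_assoc, hu, one_mul]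
    _ = u := by rw [h2, mul_one]

/-- By linearity only `X ^ k` matters, and `diagSum_X_mul` is then a linear recursion in `k` with
ratio `y * b * u`. This ratio is the solution of `x = y (a x + b)`, as in Lagrange inversion. -/
theorem diagSum_eq (hy : y ^ M = 0) {u : T} (hu : u * (1 - a * y) = 1) (P : T[X]) :
    diagSum M y a b P = u * P.eval (y * b * u) := by
  induction P using Polynomial.induction_on' with
  | add p q hp hq => rw [diagSum_add, hp, hq, eval_add, mul_add]
  | monomial k r =>
    rw [← C_mul_X_pow_eq_monomial, diagSum_C_mul, eval_C_mul, eval_pow, eval_X]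
    have key : diagSum M y a b (X ^ k) = u * (y * b * u) ^ k := by
      induction k with
      | zero => simpa using diagSum_one hy hu
      | succ k ih =>
        have h := diagSum_X_mul (a := a) (b := b) hy (X ^ k)
        rw [add_mul, diagSum_add, mul_assoc, diagSum_C_mul, diagSum_C_mul, ih] at h
        rw [pow_succ', pow_succ']
        linear_combination (diagSum M y a b (X * X ^ k)) * (-hu) + u * h
    rw [key]; ring

/-- The one-variable elimination formula. -/
theorem sum_coeff_firstPow (hy : y ^ M = 0) {u : T} (hu : u * (1 - a * y) = 1) (t : T) (P : T[X]) :
    ∑ g ∈ Finset.range M, y ^ g * (firstPow (C a * X + C b) (C t * X) g * P).coeff g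
      = (1 - t * y) * u * P.eval (y * b * u) := by
  have h1 := sum_range_pow_succ_shift hy
    (fun g => (firstPow (C a * X + C b) (C t * X) g * P).coeff g)
  have h2 := sum_range_pow_succ_shift hy (fun g => ((C a * X + C b) ^ g * P).coeff g)
  -- The correction subtracts `tX` from one factor; its `X` shifts the coefficient index, leaving `t
  -- * y` times the uncorrected sum.
  have h3 : ∑ g ∈ Finset.range M, y ^ (g + 1) *
        (firstPow (C a * X + C b) (C t * X) (g + 1) * P).coeff (g + 1)
      = ∑ g ∈ Finset.range M, y ^ (g + 1) * ((C a * X + C b) ^ (g + 1) * P).coeff (g + 1)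
        - t * y * diagSum M y a b P := by
    rw [diagSum, Finset.mul_sum, ← Finset.sum_sub_distrib]
    refine Finset.sum_congr rfl fun g _ => ?_
    rw [firstPow, show (C a * X + C b - C t * X) * (C a * X + C b) ^ g * P
      = (C a * X + C b) ^ (g + 1) * P - C t * ((C a * X + C b) ^ g * P * X) by ring,
      coeff_sub, coeff_C_mul, coeff_mul_X]
    ring
  have h4 := diagSum_eq (b := b) hy hu P
  have h5 : diagSum M y a b P =
    ∑ g ∈ Finset.range M, y ^ g * ((C a * X + C b) ^ g * P).coeff g := rfl
  simp only [show ∀ l d : T[X], firstPow l d 0 = 1 from fun _ _ => rfl, pow_zero] at h1 h2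
  linear_combination -h1 + h3 + h2 + (1 - t * y) * h4 - h5
end

/-! ### Elimination of all variables. -/

section
open MvPolynomial
variable {S : Type*} [CommRing S]

/-- The linear form `∑_{j < k} tA x_j + (1 + tA) x_k + ∑_{j > k} (1 - t + tA) x_j`. -/
noncomputable def linForm (t A : S) {N : ℕ} (k : Fin N) : MvPolynomial (Fin N) S :=
  ∑ j : Fin N, C (if j < k then t * A else if j = k then 1 + t * A else 1 - t + t * A) * X j

/-- `∑_g y^g [x^g] ∏_k l_k^{g_k}`, the first factor of each power being corrected by `t x_k`. -/
noncomputable def masterSum (M : ℕ) (t A : S) {N : ℕ} (y : Fin N → S) : S :=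
  ∑ g : Fin N → Fin M, (∏ k, y k ^ (g k : ℕ)) *
    coeff (Finsupp.equivFunOnFinite.symm fun k => (g k : ℕ))
      (∏ k, firstPow (linForm t A k) (C t * X k) (g k))

/-- The effect of eliminating a letter on the parameter of `linForm`. -/
noncomputable def elimStep (t A y : S) : S := A * (1 - t * y) * Ring.inverse (1 - (1 + t * A) * y)

theorem finSuccEquiv_linForm_zero (t A : S) (N : ℕ) :
    finSuccEquiv S N (linForm t A 0) = Polynomial.C (C (1 + t * A)) * Polynomial.X +
      Polynomial.C (C (1 - t + t * A) * ∑ j, X j) := by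
  rw [linForm, Fin.sum_univ_succ]
  simp [Finset.mul_sum, finSuccEquiv_apply]

theorem finSuccEquiv_linForm_succ (t A : S) {N : ℕ} (k : Fin N) :
    finSuccEquiv S N (linForm t A k.succ) = Polynomial.C (C (t * A)) * Polynomial.X +
      Polynomial.C (linForm t A k) := by
  rw [linForm, Fin.sum_univ_succ]
  simp [linForm, finSuccEquiv_apply]

/-- `A` enters every coefficient through the same summand `tA`. Hence substituting a multiple of `∑
x_j` for an eliminated variable stays within the family of these forms. -/
theorem linForm_add (t A B : S) {N : ℕ} (k : Fin N) :
    linForm t A k + C (t * (B - A)) * ∑ j, X j = linForm t B k := by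
  rw [linForm, linForm, Finset.mul_sum, ← Finset.sum_add_distrib]
  refine Finset.sum_congr rfl fun j _ => ?_
  rw [← add_mul, ← C_add]
  congr 2
  split_ifs <;> ring

theorem inverse_mul_of_nilpotent {y : S} {M : ℕ} (hy : y ^ M = 0) (a : S) :
    Ring.inverse (1 - a * y) * (1 - a * y) = 1 :=
  Ring.inverse_mul_cancel _ (IsNilpotent.isUnit_one_sub ⟨M, by rw [mul_pow, hy, mul_zero]⟩)

/-- The one-variable formula in `x_0` evaluates the other forms at `x_0 = y_0 (1 - t + tA) u ∑ x_j`,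
which only changes their parameter. -/
theorem masterSum_succ {M : ℕ} (t A : S) {N : ℕ} (y : Fin (N + 1) → S) (hy : y 0 ^ M = 0) :
    masterSum M t A y = (1 - t * y 0) * Ring.inverse (1 - (1 + t * A) * y 0) *
      masterSum M t (elimStep t A (y 0)) (Fin.tail y) := by
  set u := Ring.inverse (1 - (1 + t * A) * y 0) with hu
  have hu1 : u * (1 - (1 + t * A) * y 0) = 1 := inverse_mul_of_nilpotent hy _
  have hA : t * (elimStep t A (y 0) - A) = t * A * (y 0 * (1 - t + t * A) * u) := by
    rw [elimStep, ← hu]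
    linear_combination (t * A) * hu1
  have hform : ∀ k : Fin N, (finSuccEquiv S N (linForm t A k.succ)).eval
      (C (y 0) * (C (1 - t + t * A) * ∑ j, X j) * C u) = linForm t (elimStep t A (y 0)) k := by
    intro k
    rw [finSuccEquiv_linForm_succ, ← linForm_add t A (elimStep t A (y 0)), hA]
    simp only [Polynomial.eval_add, Polynomial.eval_mul, Polynomial.eval_C, Polynomial.eval_X,
      C_mul]
    ring
  rw [masterSum, masterSum, ← (Fin.consEquiv fun _ => Fin M).sum_comp, Fintype.sum_prod_type_right,
    Finset.mul_sum]
  refine Finset.sum_congr rfl fun g _ => ?_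
  have hone := sum_coeff_firstPow (T := MvPolynomial (Fin N) S) (M := M) (y := C (y 0))
    (a := C (1 + t * A)) (b := C (1 - t + t * A) * ∑ j, X j) (u := C u)
    (by rw [← C_pow, hy, C_0])
    (by rw [← C_1, ← C_mul, ← C_sub, ← C_mul, hu1]) (C t)
    (∏ k : Fin N, firstPow (finSuccEquiv S N (linForm t A k.succ)) (Polynomial.C (C t * X k)) (g k))
  rw [Polynomial.eval_prod] at hone
  have hev : ∀ k : Fin N, (firstPow (finSuccEquiv S N (linForm t A k.succ))
        (Polynomial.C (C t * X k)) (g k)).eval (C (y 0) * (C (1 - t + t * A) * ∑ j, X j) * C u)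
      = firstPow (linForm t (elimStep t A (y 0)) k) (C t * X k) (g k) := by
    intro k
    rw [← Polynomial.coe_evalRingHom, map_firstPow]
    simp only [Polynomial.coe_evalRingHom, hform, Polynomial.eval_C]
  simp only [hev] at hone
  have hcoeff := congrArg (coeff (Finsupp.equivFunOnFinite.symm fun k => (g k : ℕ))) hone
  rw [← C_1, ← C_mul, ← C_sub, ← C_mul, coeff_C_mul, coeff_sum,
    ← Fin.sum_univ_eq_sum_range (fun g0 => coeff _ (C (y 0) ^ g0 * _))] at hcoeff
  rw [mul_left_comm, ← hcoeff, Finset.mul_sum]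
  refine Finset.sum_congr rfl fun g0 _ => ?_
  have hcons : (Finsupp.equivFunOnFinite.symm fun k =>
      ((Fin.consEquiv (fun _ => Fin M) (g0, g) k : Fin M) : ℕ)) =
      Finsupp.cons (g0 : ℕ) (Finsupp.equivFunOnFinite.symm fun k => (g k : ℕ)) := by
    ext k
    refine Fin.cases ?_ (fun k => ?_) k <;> simp [Fin.consEquiv]
  rw [hcons, ← finSuccEquiv_coeff_coeff, map_prod, Fin.prod_univ_succ, Fin.prod_univ_succ]
  have hm : ∀ (l d : MvPolynomial (Fin (N + 1)) S) (n : ℕ), finSuccEquiv S N (firstPow l d n) =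
      firstPow (finSuccEquiv S N l) (finSuccEquiv S N d) n :=
    fun l d n => by cases n <;> simp [firstPow]
  have hC : ∀ r : S, finSuccEquiv S N (C r) = Polynomial.C (C r) := fun r => by
    simp [finSuccEquiv_apply]
  simp only [hm, map_mul, hC, finSuccEquiv_X_zero, finSuccEquiv_X_succ, finSuccEquiv_linForm_zero,
    Fin.consEquiv, Equiv.coe_fn_mk, Fin.cons_zero, Fin.cons_succ, Fin.tail]
  rw [← C_pow, coeff_C_mul]
  ring

/-- The prefactor in `masterSum_succ`, multiplied by `A`, is the new parameter, so the product
telescopes. -/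
theorem mul_masterSum {M : ℕ} (t A : S) {N : ℕ} (y : Fin N → S) (hy : ∀ k, y k ^ M = 0) :
    A * masterSum M t A y = (List.ofFn y).foldl (elimStep t) A := by
  induction N generalizing A with
  | zero =>
    rw [masterSum, Fintype.sum_unique, Finset.univ_eq_empty, Finset.prod_empty, Finset.prod_empty,
      Subsingleton.elim (Finsupp.equivFunOnFinite.symm _) (0 : Fin 0 →₀ ℕ), coeff_zero_one]
    simp
  | succ N ih =>
    rw [masterSum_succ t A y (hy 0), List.ofFn_succ, List.foldl_cons]
    refine Eq.trans ?_ (ih (elimStep t A (y 0)) (Fin.tail y) fun k => hy k.succ)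
    rw [elimStep]
    ring
end

/-! ### The barred order and `maj - exc`. -/

/-- The comparison key of the position `i`: excedance values are smaller than all others. -/
def barKey {n : ℕ} (π : Equiv.Perm (Fin n)) (i : Fin n) : Bool ×ₗ Fin n :=
  toLex (decide (π i ≤ i), π i)

open Classical in
/-- The descents of `π` with respect to `barKey`. -/
noncomputable def dexSet {n : ℕ} (π : Equiv.Perm (Fin n)) : Finset (Fin n) :=
  Finset.univ.filter fun i => ∃ h : (i : ℕ) + 1 < n, barKey π ⟨(i : ℕ) + 1, h⟩ < barKey π i

theorem barKey_injective {n : ℕ} (π : Equiv.Perm (Fin n)) : Function.Injective (barKey π) := by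
  intro i j h
  have := congrArg (fun x => (ofLex x).2) h
  exact π.injective this

theorem sum_range_succ_mul_sub (x : ℕ → ℤ) (n : ℕ) :
    ∑ i ∈ Finset.range n, ((i : ℤ) + 1) * (x i - x (i + 1)) =
      ∑ i ∈ Finset.range n, x i - n * x n := by
  induction n with
  | zero => simp
  | succ n ih => rw [Finset.sum_range_succ, Finset.sum_range_succ, ih]; push_cast; ring

/-- With `x` the indicator of excedances, the indicators of ordinary and barred descents at `i`
differ by `x i - x (i + 1)`: an excedance followed by a non-excedance is always an ordinary descent,
the opposite pattern never. Abel summation turns the weighted differences into `exc π`. -/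
theorem sum_dexSet_add_exc {n : ℕ} (π : Equiv.Perm (Fin n)) :
    ∑ i ∈ dexSet π, ((i : ℕ) + 1) + exc π = maj π := by
  classical
  let x : ℕ → ℤ := fun j => if h : j < n then (if (⟨j, h⟩ : Fin n) < π ⟨j, h⟩ then 1 else 0) else 0
  have hx := sum_range_succ_mul_sub x n
  have hn : x n = 0 := by simp [x]
  rw [hn, mul_zero, sub_zero,
    ← Fin.sum_univ_eq_sum_range (fun i => ((i : ℤ) + 1) * (x i - x (i + 1))),
    ← Fin.sum_univ_eq_sum_range] at hx
  have hexc : (exc π : ℤ) = ∑ i : Fin n, x i := by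
    rw [exc, excSet, Finset.card_filter]
    push_cast
    exact Finset.sum_congr rfl fun i _ => by simp [x]
  have hterm : ∀ i : Fin n, (if i ∈ desSet π then (i : ℤ) + 1 else 0) =
      (if i ∈ dexSet π then (i : ℤ) + 1 else 0) + ((i : ℤ) + 1) * (x i - x (i + 1)) := by
    intro i
    by_cases h : (i : ℕ) + 1 < n
    · simp only [desSet, dexSet, Finset.mem_filter, Finset.mem_univ, true_and, h, exists_true_left,
        barKey, Prod.Lex.toLex_lt_toLex, x, i.isLt, dif_pos, Fin.lt_def, Fin.le_def, Fin.eta]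
      have hne : (π ⟨i + 1, h⟩ : ℕ) ≠ π i := by
        intro he
        have := congrArg Fin.val (π.injective (Fin.ext he))
        simp at this
      generalize (π ⟨i + 1, h⟩ : ℕ) = b at hne ⊢
      generalize (π i : ℕ) = a at hne ⊢
      by_cases h1 : (i : ℕ) < a <;> by_cases h2 : (i : ℕ) + 1 < b <;>
        by_cases h3 : b < a <;>
        simp [h1, h2, h3, not_le.2, not_lt.1] <;> omega
    · have hi : (i : ℕ) + 1 = n := by omega
      have : ¬ i < π i := by
        rw [Fin.lt_def]; have := (π i).isLt; omega
      simp [desSet, dexSet, h, x, this]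
  have hsum := Finset.sum_congr (rfl : (Finset.univ : Finset (Fin n)) = _) fun i _ => hterm i
  rw [Finset.sum_add_distrib, hx, ← hexc, ← Finset.sum_filter, ← Finset.sum_filter,
    Finset.filter_mem_eq_inter, Finset.filter_mem_eq_inter, Finset.univ_inter,
    Finset.univ_inter] at hsum
  zify [maj]
  exact hsum.symm

/-! ### Partitions compatible with a permutation. -/

/-- `s` decreases weakly, strictly at the positions in `D`, and its last value is at least `m`. -/
def IsDescending (D : ℕ → Prop) {n N : ℕ} (m : ℕ) (s : Fin n → Fin N) : Prop :=
  ∀ j : Fin n, (if h : (j : ℕ) + 1 < n then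
    (s ⟨j + 1, h⟩ : ℕ) + (open Classical in if D j then 1 else 0) else m) ≤ s j

theorem isDescending_snoc (D : ℕ → Prop) {n N : ℕ} (m : ℕ) (s : Fin n → Fin N) (k : Fin N) :
    IsDescending D m (Fin.snoc s k : Fin (n + 1) → Fin N) ↔
      m ≤ k ∧ IsDescending D (k + (open Classical in if D (n - 1) then 1 else 0)) s := by
  rw [IsDescending, Fin.forall_fin_succ', and_comm]
  refine and_congr (by simp) (forall_congr' fun j => ?_)
  by_cases h : (j : ℕ) + 1 < n
  · have e : (Fin.snoc s k : Fin (n + 1) → Fin N) ⟨(j : ℕ) + 1, by omega⟩ = s ⟨j + 1, h⟩ :=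
      Fin.snoc_castSucc (α := fun _ => Fin N) k s ⟨j + 1, h⟩
    simp [h, e]
  · have hj : (j : ℕ) = n - 1 := by omega
    have e : (⟨(j : ℕ) + 1, by omega⟩ : Fin (n + 1)) = Fin.last n := Fin.ext (by simp; omega)
    have hD' : D (n - 1) ↔ D j := by rw [hj]
    by_cases hD : D j
    · simp [h, e, hD, hD'.2 hD]
    · simp [h, e, hD, mt hD'.1 hD]

theorem one_sub_mul_sum_geom {R : Type*} [CommRing R] {x : R} {N : ℕ} (hx : x ^ N = 0) (m : ℕ) :
    (1 - x) * ∑ k : Fin N, (if m ≤ (k : ℕ) then x ^ (k : ℕ) else 0) = x ^ m := by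
  rw [Fin.sum_univ_eq_sum_range (fun k => if m ≤ k then x ^ k else 0)]
  rcases le_total N m with h | h
  · rw [Finset.sum_eq_zero fun k hk => if_neg (by have := Finset.mem_range.1 hk; omega), mul_zero,
      pow_eq_zero_of_le h hx]
  · rw [← Finset.sum_filter, show (Finset.range N).filter (m ≤ ·) = Finset.Ico m N by
      ext; simp [and_comm], mul_comm, geom_sum_Ico_mul_neg _ h, hx, sub_zero]

open Classical in
/-- The generating function of `P`-partitions of a chain. -/
theorem sum_isDescending {R : Type*} [CommRing R] {q : R} {N : ℕ} (hq : q ^ N = 0) {u : ℕ → R}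
    (u0 : u 0 = 1) (hu : ∀ n, u (n + 1) * (1 - q ^ (n + 1)) = u n) (D : ℕ → Prop) (n m : ℕ) :
    ∑ s : Fin n → Fin N, (if IsDescending D m s then ∏ j, q ^ (s j : ℕ) else 0) =
      q ^ (n * m) * q ^ (∑ j ∈ Finset.range (n - 1), if D j then j + 1 else 0) * u n := by
  induction n generalizing m with
  | zero => simp [IsDescending, u0]
  | succ n ih =>
    rw [← (Fin.snocEquiv fun _ => Fin N).sum_comp, Fintype.sum_prod_type]
    have hk : ∀ k : Fin N, ∑ s : Fin n → Fin N,
        (if IsDescending D m ((Fin.snocEquiv fun _ => Fin N) (k, s)) then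
          ∏ j, q ^ (((Fin.snocEquiv fun _ => Fin N) (k, s) j : Fin N) : ℕ) else 0) =
        q ^ (∑ j ∈ Finset.range (n + 1 - 1), if D j then j + 1 else 0) * u n *
          (if m ≤ (k : ℕ) then (q ^ (n + 1)) ^ (k : ℕ) else 0) := by
      intro k
      -- A forced strict drop before the last entry raises the `n` earlier entries by one each. For
      -- `n = 0` the truncated `n - 1` is harmless, since the exponent is multiplied by `n`.
      have he : q ^ (∑ j ∈ Finset.range (n + 1 - 1), if D j then j + 1 else 0) =
          q ^ (∑ j ∈ Finset.range (n - 1), if D j then j + 1 else 0) *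
            q ^ (n * if D (n - 1) then 1 else 0) := by
        rcases n with _ | n
        · simp
        · rw [← pow_add]
          simp [Finset.sum_range_succ]
      by_cases h : m ≤ (k : ℕ)
      · simp only [Fin.snocEquiv, Equiv.coe_fn_mk, isDescending_snoc, h, true_and, if_true,
          Fin.prod_univ_castSucc, Fin.snoc_castSucc (α := fun _ => Fin N), Fin.snoc_last]
        simp only [← ite_zero_mul, ← Finset.sum_mul, ih, he, mul_add]
        ring
      · simp [Fin.snocEquiv, isDescending_snoc, h]
    rw [Finset.sum_congr rfl fun k _ => hk k, ← Finset.mul_sum, ← hu n]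
    have hg := one_sub_mul_sum_geom (x := q ^ (n + 1)) (N := N)
      (by rw [← pow_mul, mul_comm, pow_mul, hq, zero_pow (by omega)]) m
    rw [pow_mul q (n + 1) m, ← hg]
    ring

/-- Equal neighbours in `s` need increasing keys, so `s` has to jump exactly where the keys descend;
`Fin.rev` turns increasing into decreasing. -/
theorem strictMono_barKey_iff {n N : ℕ} (π : Equiv.Perm (Fin n)) (s : Fin n → Fin N) :
    StrictMono (fun j => toLex (s j, barKey π j)) ↔
      IsDescending (fun j => ∃ h : j < n, (⟨j, h⟩ : Fin n) ∈ dexSet π) 0 (fun j => (s j).rev) := by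
  rcases n with _ | n
  · simp [IsDescending, StrictMono]
  rw [Fin.strictMono_iff_lt_succ, IsDescending, Fin.forall_fin_succ']
  simp only [Fin.val_last, lt_self_iff_false, dite_false, zero_le, and_true]
  refine forall_congr' fun j => ?_
  have e : (⟨(j : ℕ) + 1, by omega⟩ : Fin (n + 1)) = j.succ := rfl
  have hne : barKey π j.succ ≠ barKey π j.castSucc := fun h => by
    simpa [Fin.ext_iff] using barKey_injective π h
  have hd : (∃ h : (j : ℕ) < n + 1, (⟨j, h⟩ : Fin (n + 1)) ∈ dexSet π) ↔
      barKey π j.succ < barKey π j.castSucc := by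
    simp only [dexSet, Finset.mem_filter, Finset.mem_univ, true_and]
    constructor
    · rintro ⟨_, _, h⟩; exact h
    · intro h; exact ⟨by omega, by simp, h⟩
  simp only [Fin.val_castSucc, add_lt_add_iff_right, j.isLt, dif_pos, hd, e,
    Prod.Lex.toLex_lt_toLex, Fin.val_rev, Fin.lt_def, Fin.ext_iff]
  have h1 := (s j.castSucc).isLt
  have h2 := (s j.succ).isLt
  by_cases hlt : barKey π j.succ < barKey π j.castSucc
  · simp only [hlt, if_true, hlt.not_gt, and_false, or_false]
    omega
  · have hgt := lt_of_le_of_ne (not_lt.1 hlt) hne.symm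
    simp only [hlt, if_false, hgt, and_true]
    omega

open Classical in
theorem sum_strictMono_barKey {R : Type*} [CommRing R] {q : R} {N : ℕ} (hq : q ^ N = 0) {u : ℕ → R}
    (u0 : u 0 = 1) (hu : ∀ n, u (n + 1) * (1 - q ^ (n + 1)) = u n) {n : ℕ}
    (π : Equiv.Perm (Fin n)) :
    ∑ s : Fin n → Fin N, (if StrictMono (fun j => toLex (s j, barKey π j)) then
      ∏ j, q ^ ((s j).rev : ℕ) else 0) = q ^ (maj π - exc π) * u n := by
  simp only [strictMono_barKey_iff]
  have h := sum_isDescending hq u0 hu (fun j => ∃ h : j < n, (⟨j, h⟩ : Fin n) ∈ dexSet π) n 0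
  rw [← (Equiv.piCongrRight fun _ : Fin n => (Fin.revPerm : Equiv.Perm (Fin N))).sum_comp] at h
  refine Eq.trans (Finset.sum_congr rfl fun s _ => ?_) (h.trans ?_)
  · congr 1
  · rw [mul_zero, pow_zero, one_mul]
    congr 2
    rw [← sum_dexSet_add_exc π, Nat.add_sub_cancel]
    rcases n with _ | n
    · simp [Finset.eq_empty_of_isEmpty]
    · have hlast : Fin.last n ∉ dexSet π := by simp [dexSet]
      have hR : ∑ i ∈ dexSet π, ((i : ℕ) + 1) = ∑ i, if i ∈ dexSet π then (i : ℕ) + 1 else 0 := by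
        rw [← Finset.sum_filter, Finset.filter_mem_eq_inter, Finset.univ_inter]
      rw [Nat.add_sub_cancel, Finset.sum_range, hR, Fin.sum_univ_castSucc, if_neg hlast, add_zero]
      refine Finset.sum_congr rfl fun j _ => ?_
      by_cases hm : j.castSucc ∈ dexSet π
      · rw [if_pos ⟨by omega, hm⟩, if_pos hm, Fin.val_castSucc]
      · rw [if_neg (fun h => hm h.2), if_neg hm]

/-! ### Permutations compatible with `s` as restricted words. -/

/-- The letter `l` may be written at the position `i` of the block structure `s`. The letter
`(k, true)` may only stand in blocks `≤ k`, and `(k, false)` in blocks `≥ k`, but not at the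
beginning of the block `k`. -/
def IsAllowed {n N : ℕ} (s : Fin n → Fin N) (i : Fin n) (l : Fin N ×ₗ Bool) : Prop :=
  if (ofLex l).2 then s i ≤ (ofLex l).1
  else (ofLex l).1 ≤ s i ∧ ((ofLex l).1 = s i → ∃ j < i, s j = s i)

/-- The word whose sorting permutation is `π`. -/
def barWord {n N : ℕ} (s : Fin n → Fin N) (π : Equiv.Perm (Fin n)) (i : Fin n) : Fin N ×ₗ Bool :=
  toLex (s (π.symm i), decide (i ≤ π.symm i))

section
variable {n N : ℕ} {s : Fin n → Fin N}

theorem barWord_apply (π : Equiv.Perm (Fin n)) (j : Fin n) :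
    barWord s π (π j) = toLex (s j, decide (π j ≤ j)) := by
  simp [barWord]

/-- Read along `π`, the word is weakly increasing, and equal letters occur at increasing positions:
this characterizes the stable sorting permutation. -/
theorem sort_barWord {π : Equiv.Perm (Fin n)}
    (h : StrictMono fun j => toLex (s j, barKey π j)) : Tuple.sort (barWord s π) = π := by
  refine (Tuple.eq_sort_iff.2 ⟨?_, ?_⟩).symm
  · intro i j hij
    rcases hij.eq_or_lt with rfl | hij
    · exact le_rfl
    have := h hij
    simp only [Function.comp, barWord_apply, barKey, Prod.Lex.toLex_lt_toLex,
      Prod.Lex.toLex_le_toLex] at this ⊢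
    rcases this with h1 | ⟨h1, h2 | ⟨h2, -⟩⟩
    · exact Or.inl h1
    · exact Or.inr ⟨h1, h2.le⟩
    · exact Or.inr ⟨h1, h2.le⟩
  · intro i j hij he
    have := h hij
    rw [barWord_apply, barWord_apply] at he
    have h1 := congrArg (fun x => (ofLex x).1) he
    have h2 := congrArg (fun x => (ofLex x).2) he
    simp only [ofLex_toLex] at h1 h2
    simpa [barKey, Prod.Lex.toLex_lt_toLex, h1, h2] using this

theorem isAllowed_barWord (hs : Monotone s) (π : Equiv.Perm (Fin n)) (i : Fin n) :
    IsAllowed s i (barWord s π i) := by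
  obtain ⟨j, rfl⟩ := π.surjective i
  rw [barWord_apply, IsAllowed]
  by_cases h : π j ≤ j
  · simpa [h] using hs h
  · have h' := not_le.1 h
    simpa [h] using ⟨hs h'.le, fun he => ⟨j, h', he⟩⟩

/-- If a barred letter were sorted to a place not before its position, both would lie in one block,
and not at its beginning. The preceding sorted letter is then the same barred letter, strictly to
the left, and by induction it lies too far right. -/
theorem lt_sort_of_barred (hs : Monotone s) {w : Fin n → Fin N ×ₗ Bool}
    (hw : ∀ i, IsAllowed s i (w i)) (hc : ∀ j, (ofLex (w (Tuple.sort w j))).1 = s j) (j : Fin n)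
    (hj : (ofLex (w (Tuple.sort w j))).2 = false) : j < Tuple.sort w j := by
  obtain ⟨j, hjn⟩ := j
  induction j with
  | zero =>
    by_contra hle
    have ha := hw (Tuple.sort w ⟨0, hjn⟩)
    simp only [IsAllowed, hj, hc] at ha
    have h0 : Tuple.sort w ⟨0, hjn⟩ = ⟨0, hjn⟩ := by
      simpa [Fin.ext_iff, Fin.lt_def] using hle
    rw [h0] at ha
    obtain ⟨k, hk, -⟩ := ha.2 rfl
    simp [Fin.lt_def] at hk
  | succ j ih =>
    by_contra hle
    have hle' := not_lt.1 hle
    have ha := hw (Tuple.sort w ⟨j + 1, hjn⟩)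
    simp only [IsAllowed, hj, hc] at ha
    obtain ⟨k, hk, hks⟩ := ha.2 (le_antisymm ha.1 (hs hle'))
    have hlt : (⟨j, by omega⟩ : Fin n) < ⟨j + 1, hjn⟩ := by simp [Fin.lt_def]
    have hkj : k ≤ (⟨j, by omega⟩ : Fin n) := by
      have := hk.trans_le hle'
      rw [Fin.lt_def] at this
      rw [Fin.le_def]
      exact Nat.lt_succ_iff.1 this
    have hsj : s ⟨j, by omega⟩ = s ⟨j + 1, hjn⟩ := by
      refine le_antisymm (hs hlt.le) ?_
      calc s ⟨j + 1, hjn⟩ ≤ s (Tuple.sort w ⟨j + 1, hjn⟩) := ha.1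
        _ = s k := hks.symm
        _ ≤ _ := hs hkj
    have hwle := Tuple.monotone_sort w hlt.le
    simp only [Function.comp] at hwle
    have hfst : (ofLex (w (Tuple.sort w ⟨j, by omega⟩))).1 =
      (ofLex (w (Tuple.sort w ⟨j + 1, hjn⟩))).1 := by rw [hc, hc, hsj]
    have hsnd : (ofLex (w (Tuple.sort w ⟨j, by omega⟩))).2 = false := by
      rcases Prod.Lex.le_iff.1 hwle with h | ⟨-, h⟩
      · exact absurd hfst h.ne
      · rw [hj] at h; exact le_bot_iff.1 h
    have h1 := ih (by omega) hsnd
    have h2 : Tuple.sort w ⟨j, by omega⟩ < Tuple.sort w ⟨j + 1, hjn⟩ := by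
      refine (Tuple.eq_sort_iff.1 (rfl : Tuple.sort w = _)).2 _ _ hlt ?_
      exact ofLex.injective (Prod.ext hfst (hsnd.trans hj.symm))
    simp only [Fin.lt_def, Fin.le_def] at h1 h2 hle'
    omega

/-- The mirror image of `lt_sort_of_barred`, by induction from the right end. No exception at block
ends is needed, since the inequality to be shown is weak. -/
theorem sort_le_of_not_barred (hs : Monotone s) {w : Fin n → Fin N ×ₗ Bool}
    (hw : ∀ i, IsAllowed s i (w i)) (hc : ∀ j, (ofLex (w (Tuple.sort w j))).1 = s j) (j : Fin n)
    (hj : (ofLex (w (Tuple.sort w j))).2 = true) : Tuple.sort w j ≤ j := by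
  induction hd : n - (j : ℕ) generalizing j with
  | zero => have := j.isLt; omega
  | succ d ih =>
    by_contra hlt
    have hlt' := not_le.1 hlt
    have ha := hw (Tuple.sort w j)
    simp only [IsAllowed, hj, hc, if_true] at ha
    have hj1 : (j : ℕ) + 1 < n := by
      rw [Fin.lt_def] at hlt'
      have := (Tuple.sort w j).isLt
      omega
    have hjj : j < ⟨j + 1, hj1⟩ := by simp [Fin.lt_def]
    have hle : (⟨j + 1, hj1⟩ : Fin n) ≤ Tuple.sort w j := by
      rw [Fin.le_def]; exact hlt'
    have hsj : s ⟨j + 1, hj1⟩ = s j := le_antisymm ((hs hle).trans ha) (hs hjj.le)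
    have hwle := Tuple.monotone_sort w hjj.le
    simp only [Function.comp] at hwle
    have hfst : (ofLex (w (Tuple.sort w j))).1 =
      (ofLex (w (Tuple.sort w ⟨j + 1, hj1⟩))).1 := by rw [hc, hc, hsj]
    have hsnd : (ofLex (w (Tuple.sort w ⟨j + 1, hj1⟩))).2 = true := by
      rcases Prod.Lex.le_iff.1 hwle with h | ⟨-, h⟩
      · exact absurd hfst h.ne
      · rw [hj] at h; exact top_le_iff.1 h
    have h1 := ih ⟨j + 1, hj1⟩ hsnd (by simp; omega)
    have h2 : Tuple.sort w j < Tuple.sort w ⟨j + 1, hj1⟩ := by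
      refine (Tuple.eq_sort_iff.1 (rfl : Tuple.sort w = _)).2 _ _ hjj ?_
      exact ofLex.injective (Prod.ext hfst (hj.trans hsnd.symm))
    exact absurd (h2.trans_le h1) hle.not_gt

theorem decide_sort_le (hs : Monotone s) {w : Fin n → Fin N ×ₗ Bool}
    (hw : ∀ i, IsAllowed s i (w i)) (hc : ∀ j, (ofLex (w (Tuple.sort w j))).1 = s j) (j : Fin n) :
    decide (Tuple.sort w j ≤ j) = (ofLex (w (Tuple.sort w j))).2 := by
  cases h : (ofLex (w (Tuple.sort w j))).2
  · simpa using lt_sort_of_barred hs hw hc j h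
  · simpa using sort_le_of_not_barred hs hw hc j h

theorem strictMono_barKey_sort (hs : Monotone s) {w : Fin n → Fin N ×ₗ Bool}
    (hw : ∀ i, IsAllowed s i (w i)) (hc : ∀ j, (ofLex (w (Tuple.sort w j))).1 = s j) :
    StrictMono fun j => toLex (s j, barKey (Tuple.sort w) j) := by
  intro i j hij
  have hwle := Prod.Lex.le_iff.1 (Tuple.monotone_sort w hij.le)
  simp only [Function.comp, hc] at hwle
  simp only [Prod.Lex.toLex_lt_toLex, barKey, decide_sort_le hs hw hc]
  rcases hwle with h | ⟨h, h'⟩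
  · exact Or.inl h
  · refine Or.inr ⟨h, ?_⟩
    rcases h'.eq_or_lt with h' | h'
    · refine Or.inr ⟨h', (Tuple.eq_sort_iff.1 (rfl : Tuple.sort w = _)).2 _ _ hij ?_⟩
      exact ofLex.injective (Prod.ext (by rw [hc, hc, h]) h')
    · exact Or.inl h'

theorem barWord_sort (hs : Monotone s) {w : Fin n → Fin N ×ₗ Bool}
    (hw : ∀ i, IsAllowed s i (w i)) (hc : ∀ j, (ofLex (w (Tuple.sort w j))).1 = s j) :
    barWord s (Tuple.sort w) = w := by
  funext i
  obtain ⟨j, rfl⟩ := (Tuple.sort w).surjective i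
  rw [barWord_apply, decide_sort_le hs hw hc]
  exact ofLex.injective (Prod.ext (hc j).symm rfl)

theorem pow_exc_eq_prod {R : Type*} [CommRing R] (t : R) (π : Equiv.Perm (Fin n)) :
    t ^ exc π = ∏ i, if (ofLex (barWord s π i)).2 then 1 else t := by
  rw [← Equiv.prod_comp π]
  simp only [barWord_apply, ofLex_toLex, decide_eq_true_eq]
  rw [exc, excSet, ← Finset.prod_const, Finset.prod_filter]
  exact Finset.prod_congr rfl fun i _ => by
    by_cases h : π i ≤ i
    · simp [h, h.not_gt]
    · simp [h, not_le.1 h]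

-- `barWord s` and `Tuple.sort` are inverse bijections, and bars mark exactly the excedances.
open Classical in
theorem sum_perm_eq_sum_word {R : Type*} [CommRing R] (t : R) (hs : Monotone s) :
    ∑ π : Equiv.Perm (Fin n) with StrictMono (fun j => toLex (s j, barKey π j)), t ^ exc π =
      ∑ w : Fin n → Fin N ×ₗ Bool with
        (∀ i, IsAllowed s i (w i)) ∧ ∀ j, (ofLex (w (Tuple.sort w j))).1 = s j,
        ∏ i, if (ofLex (w i)).2 then 1 else t := by
  refine Finset.sum_nbij' (barWord s) Tuple.sort ?_ ?_ ?_ ?_ ?_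
  · intro π hπ
    simp only [Finset.mem_filter, Finset.mem_univ, true_and] at hπ ⊢
    refine ⟨isAllowed_barWord hs π, fun j => ?_⟩
    rw [sort_barWord hπ, barWord_apply, ofLex_toLex]
  · intro w hw
    simp only [Finset.mem_filter, Finset.mem_univ, true_and] at hw ⊢
    exact strictMono_barKey_sort hs hw.1 hw.2
  · intro π hπ
    exact sort_barWord (by simpa using hπ)
  · intro w hw
    simp only [Finset.mem_filter, Finset.mem_univ, true_and] at hw
    exact barWord_sort hs hw.1 hw.2
  · intro π _
    exact pow_exc_eq_prod t π
end

/-! ### Contents of words. -/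

/-- The number of occurrences of each letter in a word. -/
noncomputable def content {n N : ℕ} (w : Fin n → Fin N) : Fin N →₀ ℕ :=
  ∑ i, Finsupp.single (w i) 1

section
variable {n N : ℕ}

theorem content_apply (w : Fin n → Fin N) (k : Fin N) :
    content w k = (Finset.univ.filter fun i => w i = k).card := by
  rw [content, Finsupp.finsetSum_apply, Finset.card_filter]
  exact Finset.sum_congr rfl fun i _ => Finsupp.single_apply

theorem toMultiset_content (w : Fin n → Fin N) :
    Finsupp.toMultiset (content w) = (List.ofFn w : Multiset (Fin N)) := by
  ext k
  rw [Finsupp.count_toMultiset, content_apply, ← Fin.univ_val_map, Multiset.count_map,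
    Finset.card_def, Finset.filter_val]
  simp [eq_comm]

theorem content_comp_perm (w : Fin n → Fin N) (σ : Equiv.Perm (Fin n)) :
    content (w ∘ σ) = content w :=
  Equiv.sum_comp σ fun i => Finsupp.single (w i) 1

theorem eq_of_content_eq {w w' : Fin n → Fin N} (hw : Monotone w) (hw' : Monotone w')
    (h : content w = content w') : w = w' := by
  have h1 := congrArg Finsupp.toMultiset h
  rw [toMultiset_content, toMultiset_content, Multiset.coe_eq_coe] at h1
  exact List.ofFn_injective (h1.eq_of_sortedLE hw.sortedLE_ofFn hw'.sortedLE_ofFn)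

theorem exists_monotone_content {g : Fin N →₀ ℕ} (hg : ∑ k, g k = n) :
    ∃ w : Fin n → Fin N, Monotone w ∧ content w = g := by
  set l := (Finsupp.toMultiset g).sort (· ≤ ·) with hl
  have hlen : l.length = n := by
    rw [hl, Multiset.length_sort, Finsupp.card_toMultiset, ← hg, Finsupp.sum_fintype] <;> simp
  subst hlen
  refine ⟨l.get, ?_, ?_⟩
  · rw [← List.sortedLE_ofFn_iff, List.ofFn_get]
    exact (Multiset.pairwise_sort _ _).sortedLE
  · apply Multiset.toFinsupp.symm.injective
    change Finsupp.toMultiset _ = Finsupp.toMultiset _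
    rw [toMultiset_content, List.ofFn_get, hl, Multiset.sort_eq]

theorem sum_content (w : Fin n → Fin N) : ∑ k, content w k = n := by
  simp only [content_apply]
  rw [← Finset.card_eq_sum_card_fiberwise fun _ _ => Finset.mem_coe.2 (Finset.mem_univ _),
    Finset.card_univ, Fintype.card_fin]

-- In each fibre of `s` only the least position lacks an earlier equal entry, so it alone receives
-- the corrected factor.
open Classical in
theorem prod_ite_eq_prod_firstPow {T : Type*} [CommRing T] (l d : Fin N → T) (s : Fin n → Fin N) :
    ∏ i, (if ∃ j < i, s j = s i then l (s i) else l (s i) - d (s i)) =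
      ∏ k, firstPow (l k) (d k) (content s k) := by
  rw [← Finset.prod_fiberwise Finset.univ s]
  refine Finset.prod_congr rfl fun k _ => ?_
  rw [content_apply]
  rcases (Finset.univ.filter fun i => s i = k).eq_empty_or_nonempty with he | hne
  · simp [he, firstPow]
  set F := Finset.univ.filter fun i => s i = k with hF
  have hmem : ∀ i, i ∈ F ↔ s i = k := by simp [hF]
  set m := F.min' hne with hm
  have hmF : m ∈ F := F.min'_mem hne
  obtain ⟨c, hc⟩ : ∃ c, F.card = c + 1 := ⟨F.card - 1, by have := hne.card_pos; omega⟩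
  rw [← Finset.mul_prod_erase F _ hmF, if_neg, (hmem m).1 hmF, hc, firstPow]
  · congr 1
    rw [Finset.prod_congr rfl (g := fun _ => l k), Finset.prod_const, Finset.card_erase_of_mem hmF,
      hc, Nat.add_sub_cancel]
    intro i hi
    have hi' := (hmem i).1 (Finset.mem_of_mem_erase hi)
    rw [if_pos, hi']
    refine ⟨m, lt_of_le_of_ne (F.min'_le i (Finset.mem_of_mem_erase hi))
      (Finset.ne_of_mem_erase hi).symm, ?_⟩
    rw [hi', (hmem m).1 hmF]
  · rintro ⟨j, hj, hjs⟩
    exact (F.min'_le j ((hmem j).2 (hjs.trans ((hmem m).1 hmF)))).not_gt hj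

theorem prod_pow_content {T : Type*} [CommRing T] (y : Fin N → T) (s : Fin n → Fin N) :
    ∏ k, y k ^ content s k = ∏ i, y (s i) := by
  rw [← Finset.prod_fiberwise' Finset.univ s]
  exact Finset.prod_congr rfl fun k _ => by rw [content_apply, Finset.prod_const]
end

/-! ### From words to `masterSum`, and its functional equation. -/

section
open MvPolynomial
variable {S : Type*} [CommRing S] {n N : ℕ}

-- At parameter `A = 1` the coefficients are `t`, `1 + t`, `1` below, at and above `s i`: barred
-- letters weigh `t`, unbarred ones `1`. The beginning of a block forbids its own barred letter,
-- which costs `t x_k`.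
open Classical in
theorem sum_allowed_letters (t : S) (s : Fin n → Fin N) (i : Fin n) :
    ∑ l : Fin N ×ₗ Bool, (if IsAllowed s i l then
      C (if (ofLex l).2 then 1 else t) * X (R := S) (ofLex l).1 else 0) =
    if ∃ j < i, s j = s i then linForm t 1 (s i) else linForm t 1 (s i) - C t * X (s i) := by
  have hfirst : (if ∃ j < i, s j = s i then linForm t 1 (s i)
      else linForm t 1 (s i) - C t * X (s i)) = linForm t 1 (s i) -
        ∑ k, if k = s i ∧ ¬ ∃ j < i, s j = s i then C t * X (R := S) k else 0 := by
    by_cases h : ∃ j < i, s j = s i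
    · simp [h]
    · simp only [h, not_false_eq_true, and_true, if_false, Finset.sum_ite_eq', Finset.mem_univ,
        if_true]
  rw [hfirst, linForm, ← Finset.sum_sub_distrib, ← toLex.sum_comp, Fintype.sum_prod_type]
  refine Finset.sum_congr rfl fun k _ => ?_
  rw [Fintype.sum_bool]
  simp only [IsAllowed, ofLex_toLex, if_true, if_false, Bool.false_eq_true, mul_one, C_1, one_mul]
  rcases lt_trichotomy k (s i) with h | h | h
  · simp [h, h.ne, h.le, h.not_ge]
  · by_cases hf : ∃ j < i, s j = s i
    · simp [h, hf, add_mul]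
    · simp [h, hf, add_mul]
  · simp [h.ne', h.le, h.not_ge, h.not_gt]

-- Expanding the product chooses an allowed letter at each position. Since `s` is monotone, a word
-- sorts to `s` exactly when it has the content of `s`, so one coefficient selects these words.
open Classical in
theorem sum_perm_eq_coeff (t : S) {s : Fin n → Fin N} (hs : Monotone s) :
    ∑ π : Equiv.Perm (Fin n) with StrictMono (fun j => toLex (s j, barKey π j)), t ^ exc π =
      coeff (content s) (∏ k, firstPow (linForm t 1 k) (C t * X k) (content s k)) := by
  rw [sum_perm_eq_sum_word t hs,
    ← prod_ite_eq_prod_firstPow (fun k => linForm t 1 k) (fun k => C t * X k) s]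
  simp only [← sum_allowed_letters]
  rw [Fintype.prod_sum, coeff_sum, Finset.sum_filter]
  refine Finset.sum_congr rfl fun w _ => ?_
  have hc : (∀ j, (ofLex (w (Tuple.sort w j))).1 = s j) ↔
      content (fun i => (ofLex (w i)).1) = content s := by
    have hm : Monotone ((fun i => (ofLex (w i)).1) ∘ Tuple.sort w) := fun i j hij =>
      Prod.Lex.monotone_fst _ _ (Tuple.monotone_sort w hij)
    rw [← content_comp_perm _ (Tuple.sort w)]
    exact ⟨fun h => congrArg content (funext h), fun h => congrFun (eq_of_content_eq hm hs h)⟩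
  have hX : ∏ i, X (R := S) (ofLex (w i)).1 = monomial (content fun i => (ofLex (w i)).1) 1 := by
    rw [content, monomial_sum_one]; rfl
  rw [Finset.prod_ite_zero]
  simp only [Finset.mem_univ, true_implies, hc]
  by_cases ha : ∀ i, IsAllowed s i (w i)
  · rw [if_pos ha, Finset.prod_mul_distrib, hX, ← map_prod, coeff_C_mul, coeff_monomial]
    simp [ha]
  · rw [if_neg ha, if_neg (fun h => ha h.1), coeff_zero]

theorem sum_fin_fun_eq_sum_finsuppAntidiag {M : ℕ} (f : (Fin N →₀ ℕ) → S)
    (hf : ∀ g : Fin N →₀ ℕ, M ≤ ∑ k, g k → f g = 0) :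
    ∑ g : Fin N → Fin M, f (Finsupp.equivFunOnFinite.symm fun k => (g k : ℕ)) =
      ∑ n ∈ Finset.range M, ∑ g ∈ Finset.finsuppAntidiag Finset.univ n, f g := by
  classical
  set I : Finset (Fin N →₀ ℕ) := Finset.univ.image fun g : Fin N → Fin M =>
    Finsupp.equivFunOnFinite.symm fun k => (g k : ℕ) with hI
  have h1 : ∑ g ∈ I, f g =
      ∑ g : Fin N → Fin M, f (Finsupp.equivFunOnFinite.symm fun k => (g k : ℕ)) := by
    refine Finset.sum_image fun g _ g' _ h => ?_
    funext k
    have := DFunLike.congr_fun h k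
    exact Fin.ext (by simpa using this)
  rw [← h1, ← Finset.sum_filter_add_sum_filter_not I (fun g => ∑ k, g k < M),
    Finset.sum_eq_zero (s := I.filter fun g => ¬ ∑ k, g k < M), add_zero,
    ← Finset.sum_fiberwise_of_maps_to (t := Finset.range M) (g := fun g => ∑ k, g k)]
  · refine Finset.sum_congr rfl fun n hn => Finset.sum_congr ?_ fun _ _ => rfl
    ext g
    have hn' := Finset.mem_range.1 hn
    simp only [hI, Finset.mem_filter, Finset.mem_image, Finset.mem_univ, true_and,
      Finset.mem_finsuppAntidiag, Finset.subset_univ, and_true]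
    constructor
    · exact fun h => h.2
    · intro h
      refine ⟨⟨⟨fun k => ⟨g k, ?_⟩, ?_⟩, h.trans_lt hn'⟩, h⟩
      · exact (Finset.single_le_sum (f := g) (fun _ _ => Nat.zero_le _)
          (Finset.mem_univ k)).trans_lt (h.trans_lt hn')
      · ext k; simp
  · intro g hg
    exact Finset.mem_range.2 (Finset.mem_filter.1 hg).2
  · intro g hg
    exact hf g (not_lt.1 (Finset.mem_filter.1 hg).2)

/-- Exponent vectors of degree `n` are the contents of monotone `s`. After exchanging the sums,
`sum_strictMono_barKey` sums over `s` for each `π`. -/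
theorem masterSum_eq_sum_perm {M : ℕ} {q z : S} (hq : q ^ N = 0) (hz : z ^ M = 0) {u : ℕ → S}
    (u0 : u 0 = 1) (hu : ∀ n, u (n + 1) * (1 - q ^ (n + 1)) = u n) (t : S) :
    masterSum M t 1 (fun k : Fin N => z * q ^ (k.rev : ℕ)) =
      ∑ n ∈ Finset.range M,
        z ^ n * (u n * ∑ π : Equiv.Perm (Fin n), t ^ exc π * q ^ (maj π - exc π)) := by
  classical
  rw [masterSum]
  refine (sum_fin_fun_eq_sum_finsuppAntidiag (fun g => (∏ k, (z * q ^ (k.rev : ℕ)) ^ g k) *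
      coeff g (∏ k, firstPow (linForm t 1 k) (C t * X k) (g k))) ?_).trans ?_
  · intro g hg
    simp only [mul_pow, Finset.prod_mul_distrib, Finset.prod_pow_eq_pow_sum]
    rw [pow_eq_zero_of_le hg hz, zero_mul, zero_mul]
  refine Finset.sum_congr rfl fun n _ => ?_
  have hbij : ∀ f : (Fin N →₀ ℕ) → S, ∑ g ∈ Finset.finsuppAntidiag Finset.univ n, f g =
      ∑ s : Fin n → Fin N with Monotone s, f (content s) := by
    intro f
    symm
    refine Finset.sum_nbij content ?_ ?_ ?_ fun _ _ => rfl
    · intro s _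
      simp [Finset.mem_finsuppAntidiag, sum_content]
    · intro s hs s' hs' h
      exact eq_of_content_eq (by simpa using hs) (by simpa using hs') h
    · intro g hg
      have hg' : ∑ k, g k = n := (Finset.mem_finsuppAntidiag.1 hg).1
      obtain ⟨w, hw, rfl⟩ := exists_monotone_content hg'
      exact ⟨w, by simpa using hw, rfl⟩
  have hmono : ∀ (π : Equiv.Perm (Fin n)) (s : Fin n → Fin N),
      StrictMono (fun j => toLex (s j, barKey π j)) → Monotone s := fun π s h i j hij =>
    Prod.Lex.monotone_fst _ _ (h.monotone hij)
  rw [hbij]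
  calc _ = ∑ s : Fin n → Fin N with Monotone s, ∑ π : Equiv.Perm (Fin n),
        if StrictMono (fun j => toLex (s j, barKey π j)) then
          z ^ n * t ^ exc π * ∏ j, q ^ ((s j).rev : ℕ) else 0 := by
        refine Finset.sum_congr rfl fun s hs => ?_
        rw [← sum_perm_eq_coeff t (Finset.mem_filter.1 hs).2,
          prod_pow_content (fun k : Fin N => z * q ^ (k.rev : ℕ)), Finset.prod_mul_distrib,
          Finset.prod_const, Finset.card_univ, Fintype.card_fin, Finset.sum_filter, Finset.mul_sum]
        refine Finset.sum_congr rfl fun π _ => ?_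
        split_ifs <;> ring
    _ = ∑ s : Fin n → Fin N, ∑ π : Equiv.Perm (Fin n),
        if StrictMono (fun j => toLex (s j, barKey π j)) then
          z ^ n * t ^ exc π * ∏ j, q ^ ((s j).rev : ℕ) else 0 := by
        -- A sequence that is not monotone is compatible with no `π`, so the filter may be dropped.
        refine Finset.sum_filter_of_ne fun s _ hs => ?_
        obtain ⟨π, -, hπ⟩ := Finset.exists_ne_zero_of_sum_ne_zero hs
        by_contra hm
        exact hπ (if_neg fun h => hm (hmono π s h))
    _ = _ := by
        rw [Finset.sum_comm, Finset.mul_sum, Finset.mul_sum]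
        refine Finset.sum_congr rfl fun π _ => ?_
        rw [show z ^ n * (u n * (t ^ exc π * q ^ (maj π - exc π))) =
          z ^ n * t ^ exc π * (q ^ (maj π - exc π) * u n) by ring,
          ← sum_strictMono_barKey hq u0 hu π,
          Finset.mul_sum]
        exact Finset.sum_congr rfl fun s _ => by rw [mul_ite, mul_zero]

/-- The eliminations for `z` run through `z q^N, ..., zq, z`, those for `zq` through `z q^(N+1) = 0,
z q^N, ..., zq`. Eliminating `0` fixes the parameter `1`, so the two differ by a single final step
at `z`. -/
theorem masterSum_functional_equation {M : ℕ} {q z : S} (hq : q ^ (N + 1) = 0) (hz : z ^ M = 0)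
    (t : S) :
    masterSum M t 1 (fun k : Fin (N + 1) => z * q ^ (k.rev : ℕ)) *
        (1 - (1 + t * masterSum M t 1 (fun k : Fin (N + 1) => z * q * q ^ (k.rev : ℕ))) * z) =
      masterSum M t 1 (fun k : Fin (N + 1) => z * q * q ^ (k.rev : ℕ)) * (1 - t * z) := by
  have hpow : ∀ x : S, (z * x) ^ M = 0 := fun x => by rw [mul_pow, hz, zero_mul]
  have h1 := mul_masterSum t 1 (fun k : Fin (N + 1) => z * q ^ (k.rev : ℕ)) fun k => hpow _
  have h2 := mul_masterSum t 1 (fun k : Fin (N + 1) => z * q * q ^ (k.rev : ℕ)) fun k => by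
    rw [mul_assoc]; exact hpow _
  have h0 : elimStep t 1 (0 : S) = 1 := by simp [elimStep]
  rw [one_mul, List.ofFn_succ', List.concat_eq_append, List.foldl_append] at h1
  rw [one_mul, List.ofFn_succ, List.foldl_cons, Fin.rev_zero, Fin.val_last, mul_assoc, ← pow_succ',
    hq, mul_zero, h0] at h2
  have hl : (List.ofFn fun k : Fin N => z * q ^ (k.castSucc.rev : ℕ)) =
      List.ofFn fun k : Fin N => z * q * q ^ (k.succ.rev : ℕ) := by
    congr 1
    funext k
    rw [Fin.rev_castSucc, Fin.rev_succ, Fin.val_succ, Fin.val_castSucc, pow_succ']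
    ring
  rw [hl, ← h2] at h1
  rw [h1]
  simp only [List.foldl_cons, List.foldl_nil, Fin.rev_last, Fin.val_zero, pow_zero, mul_one,
    elimStep]
  rw [mul_assoc, inverse_mul_of_nilpotent hz, mul_one]
end

/-! ### Generating functions over a ring with nilpotent `q`. -/

/-- The `(maj, exc)`-Eulerian polynomial evaluated at elements of a commutative ring. -/
def eulerianEval {R : Type*} [CommRing R] (t q : R) (n : ℕ) : R :=
  ∑ π : Equiv.Perm (Fin n), t ^ exc π * q ^ (maj π - exc π)

theorem eulerianEval_zero {R : Type*} [CommRing R] (t q : R) : eulerianEval t q 0 = 1 := by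
  simp [eulerianEval, exc, maj, excSet, desSet]

theorem map_eulerianEval {R R' : Type*} [CommRing R] [CommRing R'] (f : R →+* R') (t q : R)
    (n : ℕ) : f (eulerianEval t q n) = eulerianEval (f t) (f q) n := by
  simp [eulerianEval]

section
open PowerSeries
variable {R : Type*} [CommRing R]

theorem X_pow_dvd_sub_sum (f : R⟦X⟧) (M : ℕ) :
    (X : R⟦X⟧) ^ M ∣ f - ∑ n ∈ Finset.range M, X ^ n * C (coeff n f) := by
  refine X_pow_dvd_iff.2 fun m hm => ?_
  simp only [map_sub, map_sum, mul_comm (X ^ _) (C _), coeff_C_mul_X_pow]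
  simp [hm]

theorem eq_zero_of_X_pow_dvd {f : R⟦X⟧} (h : ∀ M, (X : R⟦X⟧) ^ M ∣ f) : f = 0 := by
  ext n
  exact X_pow_dvd_iff.1 (h (n + 1)) n (Nat.lt_succ_self n)

variable {q : R} {N : ℕ} {u : ℕ → R}

/-- The functional equation of the generating function of the Eulerian polynomials. -/
theorem eulerian_functional_equation (hq : q ^ (N + 1) = 0) (u0 : u 0 = 1)
    (hu : ∀ n, u (n + 1) * (1 - q ^ (n + 1)) = u n) (t : R) :
    let f : R⟦X⟧ := mk fun n => u n * eulerianEval t q n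
    f * (1 - (1 + C t * rescale q f) * X) = rescale q f * (1 - C t * X) := by
  intro f
  rw [← sub_eq_zero]
  -- Modulo `X ^ M` the variable becomes nilpotent, as `masterSum` requires of `z`.
  refine eq_zero_of_X_pow_dvd fun M => ?_
  rw [← Ideal.mem_span_singleton, ← Ideal.Quotient.eq_zero_iff_mem, map_sub, sub_eq_zero]
  set φ := Ideal.Quotient.mk (Ideal.span {(X : R⟦X⟧) ^ M})
  have hz : φ X ^ M = 0 := by
    rw [← map_pow]
    exact Ideal.Quotient.eq_zero_iff_mem.2 (Ideal.mem_span_singleton_self _)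
  have hφ : ∀ g : R⟦X⟧, φ g = ∑ n ∈ Finset.range M, φ X ^ n * φ (C (coeff n g)) := fun g => by
    have := Ideal.Quotient.eq_zero_iff_mem.2 (Ideal.mem_span_singleton.2 (X_pow_dvd_sub_sum g M))
    rw [map_sub, sub_eq_zero] at this
    rw [this, map_sum]
    simp only [map_mul, map_pow]
    rfl
  have hqS : φ (C q) ^ (N + 1) = 0 := by rw [← map_pow, ← map_pow, hq, map_zero, map_zero]
  have h0S : φ (C (u 0)) = 1 := by rw [u0, map_one, map_one]
  have huS : ∀ n, φ (C (u (n + 1))) * (1 - φ (C q) ^ (n + 1)) = φ (C (u n)) := fun n => by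
    rw [← hu n]; simp only [map_mul, map_sub, map_one, map_pow]
  have hcoeff : ∀ n, φ (C (u n * eulerianEval t q n)) =
      φ (C (u n)) * eulerianEval (φ (C t)) (φ (C q)) n := fun n => by
    rw [map_mul, map_mul, ← RingHom.comp_apply φ C (eulerianEval t q n), map_eulerianEval]
    rfl
  have h1 : φ f = masterSum M (φ (C t)) 1 fun k : Fin (N + 1) => φ X * φ (C q) ^ (k.rev : ℕ) := by
    rw [masterSum_eq_sum_perm (u := fun n => φ (C (u n))) hqS hz h0S huS, hφ]
    exact Finset.sum_congr rfl fun n _ => by rw [coeff_mk, hcoeff]; rfl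
  have h2 : φ (rescale q f) =
      masterSum M (φ (C t)) 1 fun k : Fin (N + 1) => φ X * φ (C q) * φ (C q) ^ (k.rev : ℕ) := by
    rw [masterSum_eq_sum_perm (u := fun n => φ (C (u n))) hqS
      (by rw [mul_pow, hz, zero_mul]) h0S huS, hφ]
    refine Finset.sum_congr rfl fun n _ => ?_
    rw [coeff_rescale, coeff_mk, map_mul C, map_mul φ, hcoeff, map_pow, map_pow, mul_pow, mul_assoc]
    rfl
  have h := masterSum_functional_equation hqS hz (φ (C t))
  rw [← h1, ← h2] at h
  simpa only [map_mul, map_sub, map_add, map_one] using h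

theorem rescale_mk_eq (u0 : u 0 = 1) (hu : ∀ n, u (n + 1) * (1 - q ^ (n + 1)) = u n) :
    rescale q (mk u) = (1 - X) * mk u := by
  ext n
  rw [coeff_rescale, coeff_mk, sub_mul, one_mul, map_sub, coeff_mk]
  rcases n with _ | n
  · simp [u0]
  · rw [coeff_succ_X_mul, coeff_mk]
    linear_combination -hu n

theorem binomialEulerian_recurrence_of_pow_eq_zero (hq : q ^ (N + 1) = 0) (u0 : u 0 = 1)
    (hu : ∀ n, u (n + 1) * (1 - q ^ (n + 1)) = u n) {p : ℕ → R} (hp : ∀ n, p n * u n = 1)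
    {b : ℕ → ℕ → R} (hb : ∀ n k, k ≤ n → u k * u (n - k) = u n * b n k) (t : R) {T : ℕ → R}
    (hT : ∀ n, T n = 1 + t * ∑ m ∈ Finset.Icc 1 n, b n m * eulerianEval t q m) (n : ℕ) :
    T (n + 1) = (1 + t) * T n +
      t * ∑ k ∈ Finset.Icc 1 n, b n k * q ^ k * eulerianEval t q k * T (n - k) := by
  have hb0 : ∀ n, b n 0 = 1 := fun n => by
    have := hb n 0 (Nat.zero_le n)
    rw [u0, one_mul, Nat.sub_zero] at this
    linear_combination p n * (-this) + (1 - b n 0) * hp n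
  have hIcc : ∀ (n : ℕ) (f : ℕ → R), ∑ k ∈ Finset.range (n + 1), f k =
      f 0 + ∑ k ∈ Finset.Icc 1 n, f k := fun n f => by
    rw [Finset.range_eq_Ico, Finset.sum_eq_sum_Ico_succ_bot (Nat.succ_pos n)]
    rfl
  set f : R⟦X⟧ := mk fun n => u n * eulerianEval t q n with hf
  have hfun := eulerian_functional_equation hq u0 hu t
  simp only [← hf] at hfun
  -- The summand `1 - C t` appears because `f` includes the term `m = 0`, which the sum in `hT`
  -- omits.
  have hgen : (mk fun n => u n * T n) = mk u * (1 - C t + C t * f) := by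
    ext n
    rw [coeff_mk, mul_add, map_add, mul_left_comm, coeff_C_mul, mul_sub, mul_one,
      mul_comm (mk u) (C t),
      map_sub, coeff_C_mul, coeff_mk, mul_comm (mk u) f, coeff_mul,
      Finset.Nat.sum_antidiagonal_eq_sum_range_succ_mk]
    have hs : ∑ k ∈ Finset.range n.succ, coeff k f * coeff (n - k) (mk u) =
        u n * ∑ k ∈ Finset.range (n + 1), b n k * eulerianEval t q k := by
      rw [Finset.mul_sum]
      refine Finset.sum_congr rfl fun k hk => ?_
      rw [hf, coeff_mk, coeff_mk]
      linear_combination eulerianEval t q k * hb n k (by have := Finset.mem_range.1 hk; omega)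
    rw [hs, hIcc, hb0, eulerianEval_zero, hT]
    ring
  set F : R⟦X⟧ := mk fun n => u n * T n with hF
  have hC : rescale q (C t) = C t := by
    ext m
    rcases m with _ | m <;> simp [coeff_C]
  have hres : rescale q F = (1 - X) * mk u * (1 - C t + C t * rescale q f) := by
    rw [hgen, map_mul, rescale_mk_eq u0 hu, map_add, map_sub, map_mul, map_one, hC]
  have hmain : F = rescale q F + X * (F + C t * (rescale q f * F)) := by
    rw [hres, hgen]
    linear_combination (mk u * C t) * hfun
  -- Here `u (n + 1) * (1 - q ^ (n + 1)) = u n` is a common factor, and the term `k = 0` of the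
  -- convolution supplies `t * T n`.
  have hc := congrArg (coeff (n + 1)) hmain
  rw [map_add, coeff_rescale, coeff_succ_X_mul, map_add, coeff_C_mul, coeff_mul,
    Finset.Nat.sum_antidiagonal_eq_sum_range_succ_mk] at hc
  have hs : ∑ k ∈ Finset.range n.succ, coeff k (rescale q f) * coeff (n - k) F =
      u n * ∑ k ∈ Finset.range (n + 1), b n k * q ^ k * eulerianEval t q k * T (n - k) := by
    rw [Finset.mul_sum]
    refine Finset.sum_congr rfl fun k hk => ?_
    rw [hF, hf, coeff_rescale, coeff_mk, coeff_mk]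
    linear_combination (q ^ k * eulerianEval t q k * T (n - k)) *
      hb n k (by have := Finset.mem_range.1 hk; omega)
  rw [hs, hIcc, hb0, eulerianEval_zero, hF, coeff_mk, coeff_mk, Nat.sub_zero] at hc
  have hu1 := hu n
  have hp1 := hp n
  generalize ∑ k ∈ Finset.Icc 1 n, b n k * q ^ k * eulerianEval t q k * T (n - k) = s at hc ⊢
  linear_combination p n * hc - p n * T (n + 1) * hu1 -
    (T (n + 1) - (1 + t) * T n - t * s) * hp1
end

/-! ### Return to `ℤ[q][t]` through the quotients by powers of `q`. -/

section
open Polynomial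

theorem map_C_qPoch {R : Type*} [CommRing R] (f : ℤ[X][X] →+* R) (n : ℕ) :
    f (C (qPoch n)) = ∏ i ∈ Finset.Icc 1 n, (1 - f qVar ^ i) := by
  simp [qPoch, qVar]

theorem eq_zero_of_qVar_pow_dvd {P : ℤ[X][X]} (h : ∀ N : ℕ, qVar ^ (N + 1) ∣ P) : P = 0 := by
  ext i j
  have h1 := h j
  rw [qVar, ← C_pow, C_dvd_iff_dvd_coeff] at h1
  rw [coeff_zero, coeff_zero]
  exact X_pow_dvd_iff.1 (h1 i) j (Nat.lt_succ_self j)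

/-- Once the image of `q` is nilpotent, each factor `1 - q^i` with `i ≥ 1` is a unit, so `(q;q)_n`
can be inverted. -/
theorem map_qBinomialEulerian_succ {R : Type*} [CommRing R] (φ : ℤ[X][X] →+* R) {N : ℕ}
    (hq : φ qVar ^ (N + 1) = 0) (n : ℕ) : φ (qBinomialEulerian (n + 1)) =
    φ ((1 + tVar) * qBinomialEulerian n +
      tVar * ∑ k ∈ Finset.Icc 1 n,
        C (qBinom n k) * qVar ^ k * qEulerian k * qBinomialEulerian (n - k)) := by
  have hunit : ∀ n, IsUnit (φ (C (qPoch n))) := fun n => by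
    rw [map_C_qPoch]
    refine IsUnit.prod_iff.2 fun i hi => IsNilpotent.isUnit_one_sub ⟨N + 1, ?_⟩
    rw [← pow_mul, mul_comm, pow_mul, hq, zero_pow]
    have := Finset.mem_Icc.1 hi
    omega
  set u : ℕ → R := fun n => Ring.inverse (φ (C (qPoch n)))
  have hp : ∀ n, φ (C (qPoch n)) * u n = 1 := fun n => Ring.mul_inverse_cancel _ (hunit n)
  have hE : ∀ k, φ (qEulerian k) = eulerianEval (φ tVar) (φ qVar) k := fun k =>
    map_eulerianEval φ tVar qVar k
  have hmain := binomialEulerian_recurrence_of_pow_eq_zero (u := u) (q := φ qVar) (t := φ tVar)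
    (p := fun n => φ (C (qPoch n))) (b := fun n k => φ (C (qBinom n k)))
    (T := fun n => φ (qBinomialEulerian n)) hq (by simp [u, qPoch]) ?_ hp ?_ ?_ n
  · simpa only [map_add, map_mul, map_one, map_sum, map_pow, hE] using hmain
  · intro n
    have h : φ (C (qPoch (n + 1))) = φ (C (qPoch n)) * (1 - φ qVar ^ (n + 1)) := by
      simp [qPoch_succ, qVar]
    have h1 := hp (n + 1)
    rw [h] at h1
    linear_combination u n * h1 - (u (n + 1) * (1 - φ qVar ^ (n + 1))) * hp n
  · intro n k hk
    have h := congrArg (fun x => φ (C x)) (qBinom_spec hk)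
    simp only [map_mul] at h
    have h1 := hp n
    have h2 := hp k
    have h3 := hp (n - k)
    rw [h] at h1
    linear_combination (-(u k * u (n - k))) * h1 +
      (u n * φ (C (qBinom n k)) * φ (C (qPoch (n - k))) * u (n - k)) * h2 +
      (u n * φ (C (qBinom n k))) * h3
  · intro n
    simp only [qBinomialEulerian, map_add, map_mul, map_one, map_sum, hE]

theorem qBinomialEulerian_succ (n : ℕ) : qBinomialEulerian (n + 1) =
    (1 + tVar) * qBinomialEulerian n +
      tVar * ∑ k ∈ Finset.Icc 1 n,
        C (qBinom n k) * qVar ^ k * qEulerian k * qBinomialEulerian (n - k) := by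
  rw [← sub_eq_zero]
  refine eq_zero_of_qVar_pow_dvd fun N => ?_
  rw [← Ideal.mem_span_singleton, ← Ideal.Quotient.eq_zero_iff_mem, map_sub, sub_eq_zero]
  refine map_qBinomialEulerian_succ (R := ℤ[X][X] ⧸ Ideal.span {qVar ^ (N + 1)})
    (Ideal.Quotient.mk _) (N := N) ?_ n
  rw [← map_pow]
  exact Ideal.Quotient.eq_zero_iff_mem.2 (Ideal.mem_span_singleton_self _)
end

theorem theorem1p4 :
    qBinomialEulerian 0 = 1 ∧
    ∀ n : ℕ, qBinomialEulerian (n + 1) =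
      (1 + tVar) * qBinomialEulerian n +
        tVar * ∑ k ∈ Finset.Icc 1 n,
          Polynomial.C (qBinom n k) * qVar ^ k * qEulerian k * qBinomialEulerian (n - k) := by
  exact ⟨by simp [qBinomialEulerian], qBinomialEulerian_succ⟩
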